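/- Let $d\ge 0$ and let $P\subset\mathbb{R}^d$ be a lattice $d$-polytope, i.e. the full-dimensional convex hull of finitely many points of $\mathbb{Z}^d$, and let $\partial P$ be the union of its facets. A triangulation of $\partial P$ is a finite geometric simplicial complex with vertices in $\partial P\cap\mathbb{Z}^d$ whose union is $\partial P$. It is called regular if there is a weight function $\omega:\partial P\cap\mathbb{Z}^d\to\mathbb{R}$ such that its simplices are exactly the cells obtained as follows: for each facet $F$ of $P$, project to $\mathbb{R}^d$ the nonempty lower faces of the lifted polytope $\operatorname{conv}\{(v,\omega(v)) : v\in F\cap\mathbb{Z}^d\}\subset\mathbb{R}^d\times\mathbb{R}$, where a lower face is a face having an outer normal vector with negative last coordinate. If $\Delta$ is a regular triangulation of $\partial P$, then $\Delta$ is polytopal: there is a simplicial $d$-polytope $Q\subset\mathbb{R}^d$ (a full-dimensional polytope all of whose facets are simplices) such that $\Delta$ is combinatorially equivalent to the boundary complex of $Q$, i.e. there is a bijection from the vertices of $\Delta$ to the vertices of the boundary complex of $Q$ under which the vertex sets of the simplices of $\Delta$ correspond exactly to the vertex sets of the nonempty proper faces of $Q$. -/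

import Mathlib

/-! ### Polytopes and their faces -/

/-- `P ⊆ ℝ^d` is a `d`-polytope: the convex hull of finitely many points, of full dimension. -/
def IsFullPolytope {d : ℕ} (P : Set (Fin d → ℝ)) : Prop :=
  (∃ V : Finset (Fin d → ℝ), P = convexHull ℝ (V : Set (Fin d → ℝ))) ∧ affineSpan ℝ P = ⊤

/-- The points of the lattice `ℤ^d ⊆ ℝ^d`. -/
def latticePoints (d : ℕ) : Set (Fin d → ℝ) :=
  Set.range fun (z : Fin d → ℤ) (i : Fin d) => (z i : ℝ)

/-- `P ⊆ ℝ^d` is a lattice `d`-polytope: the convex hull of finitely many points of `ℤ^d`, of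
full dimension. -/
def IsLatticePolytope {d : ℕ} (P : Set (Fin d → ℝ)) : Prop :=
  (∃ V : Finset (Fin d → ℝ), (V : Set (Fin d → ℝ)) ⊆ latticePoints d ∧
    P = convexHull ℝ (V : Set (Fin d → ℝ))) ∧ affineSpan ℝ P = ⊤

/-- `G` is a nonempty proper face of the polytope `P`: the set of maximizers on `P` of a linear
functional, different from `P` itself. -/
def IsProperFace {d : ℕ} (P G : Set (Fin d → ℝ)) : Prop :=
  G.Nonempty ∧ IsExposed ℝ P G ∧ G ≠ P

/-- `F` is a facet of `P`: a face of dimension `dim P - 1`. -/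
def IsFacet {d : ℕ} (P F : Set (Fin d → ℝ)) : Prop :=
  IsProperFace P F ∧
    Module.finrank ℝ (vectorSpan ℝ F) + 1 = Module.finrank ℝ (vectorSpan ℝ P)

/-- The boundary `∂P`: the union of all facets of `P`. -/
def polytopeBoundary {d : ℕ} (P : Set (Fin d → ℝ)) : Set (Fin d → ℝ) :=
  ⋃₀ {F | IsFacet P F}

/-! ### Regular subdivisions -/

/-- The convex hull in `ℝ^d × ℝ` of the points `(v, ω v)`, `v ∈ A`. -/
def liftedPolytope {d : ℕ} (A : Set (Fin d → ℝ)) (ω : (Fin d → ℝ) → ℝ) :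
    Set ((Fin d → ℝ) × ℝ) :=
  convexHull ℝ ((fun v => (v, ω v)) '' A)

/-- `G` is a lower face of `L ⊆ ℝ^d × ℝ`: a nonempty face with an outer normal vector whose last
coordinate is negative. For a polytope, these are the lower facets and all their nonempty faces. -/
def IsLowerFace {d : ℕ} (L G : Set ((Fin d → ℝ) × ℝ)) : Prop :=
  G.Nonempty ∧ ∃ l : StrongDual ℝ ((Fin d → ℝ) × ℝ), l (0, 1) < 0 ∧
    G = {x ∈ L | ∀ y ∈ L, l y ≤ l x}

/-- The (nonempty) cells of the regular subdivision of `conv A` induced by the weights `ω`: the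
projections to `ℝ^d` of the lower faces of the lifted polytope. -/
def regularSubdivision {d : ℕ} (A : Set (Fin d → ℝ)) (ω : (Fin d → ℝ) → ℝ) :
    Set (Set (Fin d → ℝ)) :=
  {C | ∃ G, IsLowerFace (liftedPolytope A ω) G ∧ C = Prod.fst '' G}

/-- The regular subdivision of `∂P` induced by the weights `ω` on `∂P ∩ ℤ^d`: each facet `F` of
`P` is subdivided by the weights on `F ∩ ℤ^d`. Only the values of `ω` on `∂P ∩ ℤ^d` matter. -/
def regularBoundarySubdivision {d : ℕ} (P : Set (Fin d → ℝ)) (ω : (Fin d → ℝ) → ℝ) :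
    Set (Set (Fin d → ℝ)) :=
  {C | ∃ F, IsFacet P F ∧ C ∈ regularSubdivision (F ∩ latticePoints d) ω}

/-! ### Triangulations of the boundary -/

/-- The simplices of a geometric simplicial complex, as subsets of `ℝ^d`. -/
def simplices {d : ℕ} (Δ : Geometry.SimplicialComplex ℝ (Fin d → ℝ)) : Set (Set (Fin d → ℝ)) :=
  {C | ∃ s ∈ Δ.faces, C = convexHull ℝ (s : Set (Fin d → ℝ))}

/-- `Δ` is a (lattice) triangulation of `∂P`: a finite geometric simplicial complex with vertices
in `∂P ∩ ℤ^d` whose simplices cover exactly `∂P`. -/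
def IsBoundaryTriangulation {d : ℕ} (P : Set (Fin d → ℝ))
    (Δ : Geometry.SimplicialComplex ℝ (Fin d → ℝ)) : Prop :=
  Δ.faces.Finite ∧ Δ.vertices ⊆ polytopeBoundary P ∩ latticePoints d ∧
    Δ.space = polytopeBoundary P

/-- `Δ` is a regular triangulation of `∂P`: a triangulation of `∂P` that is the regular
subdivision of `∂P` induced by some weight function. -/
def IsRegularBoundaryTriangulation {d : ℕ} (P : Set (Fin d → ℝ))
    (Δ : Geometry.SimplicialComplex ℝ (Fin d → ℝ)) : Prop :=
  IsBoundaryTriangulation P Δ ∧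
    ∃ ω : (Fin d → ℝ) → ℝ, simplices Δ = regularBoundarySubdivision P ω

/-! ### Simplicial polytopes and combinatorial equivalence -/

/-- `Q ⊆ ℝ^d` is a simplicial `d`-polytope: a `d`-polytope all of whose facets are simplices, i.e.
have affinely independent vertices. -/
def IsSimplicialPolytope {d : ℕ} (Q : Set (Fin d → ℝ)) : Prop :=
  IsFullPolytope Q ∧ ∀ F, IsFacet Q F →
    AffineIndependent ℝ (Subtype.val : F.extremePoints ℝ → (Fin d → ℝ))

/-- The boundary complex of a simplicial polytope `Q`, as an abstract simplicial complex: its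
faces are the vertex sets of the nonempty proper faces of `Q`. -/
def boundaryComplex {d : ℕ} (Q : Set (Fin d → ℝ)) : Set (Finset (Fin d → ℝ)) :=
  {s | ∃ G, IsProperFace Q G ∧ (s : Set (Fin d → ℝ)) = G.extremePoints ℝ}

open Classical in
/-- Two abstract simplicial complexes, given by their sets of faces, are combinatorially
equivalent: there is a bijection between their vertices that maps the faces of the first exactly
onto the faces of the second. -/
def CombinatoriallyEquivalent {V W : Type*} (K : Set (Finset V)) (L : Set (Finset W)) : Prop :=
  ∃ φ : V → W, Set.InjOn φ {v | ∃ s ∈ K, v ∈ s} ∧ (fun s => s.image φ) '' K = L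

/-! ### Linear functionals on convex hulls -/

/-! Fix `o` in the interior of `P`. Each simplex `s` of `Δ` lies in a facet, cut out by `l (v - o) =
1` for a functional with `l (v - o) ≤ 1` on `P`. Regularity supplies a functional `m` such that,
among the vertices on this facet's hyperplane, `m (v - o) ≤ ω v` with equality exactly on `s`
(`exists_facet_and_minorant`). Hence for small `ε > 0` the functional `l + ε m` is at most `1 + ε ω
v` at every `v - o`, with equality exactly for `v ∈ s`.

So the vertices are slid along their rays from `o` to `q v = (v - o) / (1 + ε ω v)`: every simplex
of `Δ` now spans an exposed face of `Q = conv (q V)`. The rays are unchanged, so the cones over the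
simplices still cover space, and this leaves no room for further faces
(`IsPolytopalRealization.exists_of_isProperFace`). Covering rests on every ray from `o` meeting the
union of the facets. -/

theorem vectorSpan_le_ker {E : Type*} [AddCommGroup E] [Module ℝ E] {S : Set E} (l : E →ₗ[ℝ] ℝ)
    (h : ∀ x ∈ S, ∀ y ∈ S, l x = l y) : vectorSpan ℝ S ≤ LinearMap.ker l := by
  rw [vectorSpan_def, Submodule.span_le]
  rintro _ ⟨x, hx, y, hy, rfl⟩
  simp [h x hx y hy]

theorem eq_zero_of_const_of_affineSpan_eq_top {E : Type*} [AddCommGroup E] [Module ℝ E]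
    {S : Set E} (hS : affineSpan ℝ S = ⊤) (l : E →ₗ[ℝ] ℝ)
    (h : ∀ x ∈ S, ∀ y ∈ S, l x = l y) : l = 0 := by
  have h1 := vectorSpan_le_ker l h
  rw [AffineSubspace.vectorSpan_eq_top_of_affineSpan_eq_top ℝ E E hS, top_le_iff] at h1
  exact LinearMap.ker_eq_top.1 h1

theorem le_on_convexHull {E : Type*} [AddCommGroup E] [Module ℝ E] {S : Set E} (l : E →ₗ[ℝ] ℝ)
    {M : ℝ} (h : ∀ a ∈ S, l a ≤ M) : ∀ x ∈ convexHull ℝ S, l x ≤ M :=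
  convexHull_min h (convex_halfSpace_le l.isLinear M)

/-- The property "at most `M`, and in the hull of the maximizers if equal to `M`" is itself convex:
a combination with positive weights reaches `M` only if both endpoints do. -/
theorem mem_convexHull_of_eq_max {E : Type*} [AddCommGroup E] [Module ℝ E] {S : Set E}
    (l : E →ₗ[ℝ] ℝ) {M : ℝ} (h : ∀ a ∈ S, l a ≤ M) {x : E} (hx : x ∈ convexHull ℝ S)
    (hxM : l x = M) : x ∈ convexHull ℝ {a ∈ S | l a = M} := by
  suffices H : convexHull ℝ S ⊆ {x | l x ≤ M ∧ (l x = M → x ∈ convexHull ℝ {a ∈ S | l a = M})} from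
    (H hx).2 hxM
  refine convexHull_min (fun a ha => ⟨h a ha, fun e => subset_convexHull ℝ _ ⟨ha, e⟩⟩) ?_
  rintro x ⟨hx1, hx2⟩ y ⟨hy1, hy2⟩ a b ha hb hab
  have e : l (a • x + b • y) = a * l x + b * l y := by simp
  refine ⟨?_, fun hM => ?_⟩
  · rw [e]
    calc a * l x + b * l y ≤ a * M + b * M := by gcongr
      _ = M := by rw [← add_mul, hab, one_mul]
  · rw [e] at hM
    rcases ha.eq_or_lt with rfl | ha
    · obtain rfl : b = 1 := by linarith
      simpa using hy2 (by linarith)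
    rcases hb.eq_or_lt with rfl | hb
    · obtain rfl : a = 1 := by linarith
      simpa using hx2 (by linarith)
    have hs : a * (M - l x) + b * (M - l y) = 0 := by
      have : a * M + b * M = M := by rw [← add_mul, hab, one_mul]
      linarith
    have h1 : 0 ≤ a * (M - l x) := mul_nonneg ha.le (by linarith)
    have h2 : 0 ≤ b * (M - l y) := mul_nonneg hb.le (by linarith)
    have h3 : a * (M - l x) = 0 := by linarith
    have h4 : b * (M - l y) = 0 := by linarith
    have h5 := (mul_eq_zero.1 h3).resolve_left ha.ne'
    have h6 := (mul_eq_zero.1 h4).resolve_left hb.ne'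
    exact convex_convexHull ℝ _ (hx2 (by linarith)) (hy2 (by linarith)) ha.le hb.le hab

/-- The face of `conv S` on which a functional attains its maximum `M` over `S`. -/
theorem maximizers_convexHull {E : Type*} [AddCommGroup E] [Module ℝ E] {S : Set E}
    (l : E →ₗ[ℝ] ℝ) {M : ℝ} (h : ∀ a ∈ S, l a ≤ M) (hne : ∃ a ∈ S, l a = M) :
    {x ∈ convexHull ℝ S | ∀ y ∈ convexHull ℝ S, l y ≤ l x} =
      convexHull ℝ {a ∈ S | l a = M} := by
  ext x
  constructor
  · rintro ⟨hx, hmax⟩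
    obtain ⟨a, ha, haM⟩ := hne
    refine mem_convexHull_of_eq_max l h hx (le_antisymm (le_on_convexHull l h x hx) ?_)
    rw [← haM]
    exact hmax a (subset_convexHull ℝ S ha)
  · intro hx
    have hxM : l x = M := convexHull_min (s := {a ∈ S | l a = M}) (fun a ha => ha.2)
      (convex_hyperplane l.isLinear M) hx
    refine ⟨convexHull_mono (fun a ha => ha.1) hx, fun y hy => ?_⟩
    rw [hxM]
    exact le_on_convexHull l h y hy

/-! ### Facets through boundary points -/

/-- A proper face of a full-dimensional polytope that is not a facet lies in a proper face of
larger dimension. -/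
theorem IsProperFace.exists_larger {d : ℕ} {P G : Set (Fin d → ℝ)} (hP : IsFullPolytope P)
    (hG : IsProperFace P G) (hF : ¬ IsFacet P G) :
    ∃ G', IsProperFace P G' ∧ G ⊆ G' ∧
      Module.finrank ℝ (vectorSpan ℝ G) < Module.finrank ℝ (vectorSpan ℝ G') := by
  obtain ⟨⟨V, hV⟩, hspan⟩ := hP
  obtain ⟨l, hl⟩ := hG.2.1 hG.1
  obtain ⟨x0, hx0⟩ := hG.1
  have hx0' := hx0
  rw [hl] at hx0'
  obtain ⟨hx0P, hx0max⟩ := hx0'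
  have hGl : ∀ g ∈ G, l g = l x0 := fun g hg => by
    rw [hl] at hg
    exact le_antisymm (hx0max g hg.1) (hg.2 x0 hx0P)
  have hmemG : ∀ g ∈ P, l g = l x0 → g ∈ G := fun g hg e => by
    rw [hl]
    exact ⟨hg, fun y hy => by rw [e]; exact hx0max y hy⟩
  have hVP : ∀ v ∈ V, v ∈ P := fun v hv => hV ▸ subset_convexHull ℝ _ hv
  have hl0 : (l : (Fin d → ℝ) →ₗ[ℝ] ℝ) ≠ 0 := fun h => hG.2.2 <|
    Set.Subset.antisymm (fun g hg => by rw [hl] at hg; exact hg.1) fun g hg =>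
      hmemG g hg ((DFunLike.congr_fun h g).trans (DFunLike.congr_fun h x0).symm)
  have hWker : vectorSpan ℝ G ≤ LinearMap.ker (l : (Fin d → ℝ) →ₗ[ℝ] ℝ) :=
    vectorSpan_le_ker _ fun x hx y hy => (hGl x hx).trans (hGl y hy).symm
  have hPtop := AffineSubspace.vectorSpan_eq_top_of_affineSpan_eq_top ℝ _ _ hspan
  have hWne : vectorSpan ℝ G ≠ LinearMap.ker (l : (Fin d → ℝ) →ₗ[ℝ] ℝ) := fun h => hF
    ⟨hG, by
      rw [hPtop, h, finrank_top]
      exact Module.Dual.finrank_ker_add_one_of_ne_zero hl0⟩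
  -- The span of `G` is not the whole hyperplane `ker l`, as `G` would then be a facet. The spare
  -- direction `u` later shows that the tilted functional is nonzero.
  obtain ⟨u, hu, huW⟩ := SetLike.exists_of_lt (lt_of_le_of_ne hWker hWne)
  obtain ⟨m, hmu, hmv⟩ : ∃ m : (Fin d → ℝ) →ₗ[ℝ] ℝ, (m u ≠ 0 ∧ vectorSpan ℝ G ≤ LinearMap.ker m) ∧
      ∃ v ∈ V, m x0 < m v := by
    obtain ⟨m, hmu, hmW⟩ := Submodule.exists_le_ker_of_notMem huW
    have : ∃ v ∈ V, m v ≠ m x0 := by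
      by_contra! hc
      have hc' : ∀ x ∈ P, m x = m x0 := fun x hx => by
        rw [hV] at hx
        exact convexHull_min (s := (V : Set (Fin d → ℝ))) (t := {y | m y = m x0}) hc
          (convex_hyperplane m.isLinear _) hx
      exact hmu (by rw [eq_zero_of_const_of_affineSpan_eq_top hspan m
        fun x hx y hy => (hc' x hx).trans (hc' y hy).symm]; rfl)
    obtain ⟨v, hv, hne⟩ := this
    rcases hne.lt_or_gt with h | h
    · exact ⟨-m, ⟨by simpa using hmu, fun x hx => by simpa using hmW hx⟩, v, hv, by simpa using h⟩
    · exact ⟨m, ⟨hmu, hmW⟩, v, hv, h⟩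
  obtain ⟨hmu, hmW⟩ := hmu
  have hGm : ∀ g ∈ G, m g = m x0 := fun g hg => by
    have := hmW (vsub_mem_vectorSpan ℝ hg hx0)
    simpa [sub_eq_zero] using this
  -- Ratio test: tilt `l` towards `m`, which is constant on `G`, until the first new point `v0` of
  -- `V` becomes a maximizer. The least ratio is the tilt `t`.
  obtain ⟨v0, hv0, hmin⟩ := Finset.exists_min_image (V.filter fun v => m x0 < m v)
    (fun v => (l x0 - l v) / (m v - m x0)) (by
      obtain ⟨v, hv, h⟩ := hmv
      exact ⟨v, Finset.mem_filter.2 ⟨hv, h⟩⟩)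
  obtain ⟨hv0V, hv0m⟩ := Finset.mem_filter.1 hv0
  set t := (l x0 - l v0) / (m v0 - m x0) with ht
  have hlv0 : l v0 < l x0 := lt_of_le_of_ne (hx0max _ (hVP _ hv0V)) fun e =>
    hv0m.ne' (hGm v0 (hmemG _ (hVP _ hv0V) e))
  have htpos : 0 < t := div_pos (sub_pos.2 hlv0) (sub_pos.2 hv0m)
  have htv0 : t * (m v0 - m x0) = l x0 - l v0 := div_mul_cancel₀ _ (sub_pos.2 hv0m).ne'
  let l' : StrongDual ℝ (Fin d → ℝ) := l + t • LinearMap.toContinuousLinearMap m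
  have hl' : ∀ x, l' x = l x + t * m x := fun x => by simp [l']
  have hmax : ∀ y ∈ P, l' y ≤ l' x0 := by
    rw [hV]
    refine le_on_convexHull (l' : (Fin d → ℝ) →ₗ[ℝ] ℝ) fun v hv => ?_
    change l' v ≤ l' x0
    rw [hl', hl']
    by_cases hm : m x0 < m v
    · have h1 := hmin v (Finset.mem_filter.2 ⟨hv, hm⟩)
      rw [le_div_iff₀ (sub_pos.2 hm)] at h1
      linarith
    · have h1 : t * m v ≤ t * m x0 := mul_le_mul_of_nonneg_left (not_lt.1 hm) htpos.le
      linarith [hx0max v (hVP v hv)]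
  have hmemG' : ∀ g ∈ P, l' g = l' x0 → g ∈ {x ∈ P | ∀ y ∈ P, l' y ≤ l' x} := fun g hg e =>
    ⟨hg, fun y hy => e ▸ hmax y hy⟩
  have hv0G' := hmemG' v0 (hVP _ hv0V) (by rw [hl', hl']; linarith)
  have hGG' : G ⊆ {x ∈ P | ∀ y ∈ P, l' y ≤ l' x} := fun g hg =>
    hmemG' g (by rw [hl] at hg; exact hg.1) (by rw [hl', hl', hGl g hg, hGm g hg])
  refine ⟨_, ⟨⟨x0, hGG' hx0⟩, fun _ => ⟨l', rfl⟩, fun h => ?_⟩, hGG', ?_⟩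
  · have h0 : (l' : (Fin d → ℝ) →ₗ[ℝ] ℝ) = 0 :=
      eq_zero_of_const_of_affineSpan_eq_top hspan _ fun x hx y hy => by
        have hx' := hx
        have hy' := hy
        rw [← h] at hx' hy'
        exact le_antisymm (hy'.2 x hx) (hx'.2 y hy)
    have h1 : l' u = 0 := DFunLike.congr_fun h0 u
    have h2 : l u = 0 := hu
    rw [hl', h2, zero_add] at h1
    exact (mul_ne_zero htpos.ne' hmu) h1
  · refine Submodule.finrank_lt_finrank_of_lt (lt_of_le_of_ne (vectorSpan_mono ℝ hGG') fun h => ?_)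
    have h1 := vsub_mem_vectorSpan ℝ hv0G' (hGG' hx0)
    rw [← h] at h1
    have h2 := hmW h1
    simp only [vsub_eq_sub, LinearMap.mem_ker, map_sub] at h2
    linarith

/-- Here `n` bounds the codimension of `G`; each enlargement raises the dimension, and a face of
dimension `d` cannot be enlarged. -/
theorem IsProperFace.exists_facet {d : ℕ} {P : Set (Fin d → ℝ)} (hP : IsFullPolytope P) :
    ∀ (n : ℕ) (G : Set (Fin d → ℝ)), IsProperFace P G →
      d ≤ Module.finrank ℝ (vectorSpan ℝ G) + n → ∃ F, IsFacet P F ∧ G ⊆ F := by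
  intro n
  induction n with
  | zero =>
    intro G hG hn
    by_contra hc
    obtain ⟨G', -, -, hlt⟩ := hG.exists_larger hP fun h => hc ⟨G, h, subset_rfl⟩
    have := Submodule.finrank_le (vectorSpan ℝ G')
    rw [Module.finrank_fin_fun] at this
    omega
  | succ n ih =>
    intro G hG hn
    by_cases hF : IsFacet P G
    · exact ⟨G, hF, subset_rfl⟩
    obtain ⟨G', hG', hsub, hlt⟩ := hG.exists_larger hP hF
    obtain ⟨F, hF, hGF⟩ := ih G' hG' (by omega)
    exact ⟨F, hF, hsub.trans hGF⟩

theorem frontier_subset_polytopeBoundary {d : ℕ} {P : Set (Fin d → ℝ)} (hP : IsFullPolytope P) :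
    frontier P ⊆ polytopeBoundary P := by
  intro x hx
  obtain ⟨⟨V, hV⟩, hspan⟩ := hP
  have hconv : Convex ℝ P := hV ▸ convex_convexHull ℝ _
  have hcl : IsClosed P := by
    rw [hV]
    exact (V.finite_toSet.isCompact_convexHull ℝ).isClosed
  have hint : (interior P).Nonempty := hconv.interior_nonempty_iff_affineSpan_eq_top.2 hspan
  -- The supporting hyperplane at `x` is strict on the interior, so the face it exposes is proper.
  obtain ⟨l, hl⟩ := geometric_hahn_banach_open_point hconv.interior isOpen_interior hx.2
  have hxP : x ∈ P := hcl.closure_eq ▸ hx.1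
  have hmax : ∀ y ∈ P, l y ≤ l x := fun y hy => by
    have h1 : y ∈ closure (interior P) := by
      rw [hconv.closure_interior_eq_closure_of_nonempty_interior hint]
      exact subset_closure hy
    exact closure_minimal (fun a ha => (hl a ha).le)
      (isClosed_le l.continuous continuous_const) h1
  have hG : IsProperFace P {z ∈ P | ∀ y ∈ P, l y ≤ l z} := by
    refine ⟨⟨x, hxP, hmax⟩, fun _ => ⟨l, rfl⟩, fun h => ?_⟩
    obtain ⟨o, ho⟩ := hint
    have h1 := interior_subset ho
    rw [← h] at h1
    exact absurd (h1.2 x hxP) (not_le.2 (hl o ho))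
  obtain ⟨F, hF, hsub⟩ := hG.exists_facet ⟨⟨V, hV⟩, hspan⟩ d _ (by omega)
  exact ⟨F, hF, hsub ⟨hxP, hmax⟩⟩

open scoped Pointwise in
/-- Every ray from an interior point meets the boundary. -/
theorem exists_pos_smul_mem_polytopeBoundary {d : ℕ} {P : Set (Fin d → ℝ)} (hP : IsFullPolytope P)
    {o : Fin d → ℝ} (ho : o ∈ interior P) {x : Fin d → ℝ} (hx : x ≠ 0) :
    ∃ c : ℝ, 0 < c ∧ o + c • x ∈ polytopeBoundary P := by
  obtain ⟨V, hV⟩ := hP.1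
  have hconv : Convex ℝ P := hV ▸ convex_convexHull ℝ _
  have hbd : Bornology.IsBounded P := by
    rw [hV]
    exact isBounded_convexHull.2 V.finite_toSet.isBounded
  -- With `o` moved to the origin, dividing `x` by its gauge lands on the frontier.
  let S := Homeomorph.addLeft o ⁻¹' P
  have hS0 : S ∈ nhds 0 := (Homeomorph.addLeft o).continuous.continuousAt.preimage_mem_nhds
    (by simpa using mem_interior_iff_mem_nhds.1 ho)
  have hSc : Convex ℝ S := hconv.translate_preimage_right o
  have hSb : Bornology.IsVonNBounded ℝ S := by
    rw [NormedSpace.isVonNBounded_iff]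
    have : S = -o +ᵥ P := by
      ext z
      simp [S, Set.mem_vadd_set_iff_neg_vadd_mem]
    rw [this]
    exact hbd.vadd (-o)
  have hg : 0 < gauge S x := (gauge_pos (absorbent_nhds_zero hS0) hSb).2 hx
  refine ⟨(gauge S x)⁻¹, inv_pos.2 hg, frontier_subset_polytopeBoundary hP ?_⟩
  have h1 : (gauge S x)⁻¹ • x ∈ frontier S := by
    rw [← gauge_eq_one_iff_mem_frontier hSc hS0, gauge_smul_of_nonneg (inv_pos.2 hg).le,
      smul_eq_mul, inv_mul_cancel₀ hg.ne']
  rw [← (Homeomorph.addLeft o).preimage_frontier] at h1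
  exact h1

/-- A facet is cut out by a functional normalized with respect to an interior point. -/
theorem IsProperFace.exists_normalized {d : ℕ} {P F : Set (Fin d → ℝ)} {o : Fin d → ℝ}
    (hF : IsProperFace P F) (ho : o ∈ interior P) :
    ∃ l : StrongDual ℝ (Fin d → ℝ), (∀ x ∈ P, l (x - o) ≤ 1) ∧
      ∀ x ∈ P, l (x - o) = 1 ↔ x ∈ F := by
  obtain ⟨l, hl⟩ := hF.2.1 hF.1
  obtain ⟨x0, hx0⟩ := hF.1
  rw [hl] at hx0
  obtain ⟨hx0P, hmax⟩ := hx0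
  have hpos : l o < l x0 := by
    refine lt_of_le_of_ne (hmax o (interior_subset ho)) fun e => ?_
    -- A linear functional with an interior maximum vanishes, and would then expose all of `P`.
    have hloc : IsLocalMax l o := by
      filter_upwards [mem_interior_iff_mem_nhds.1 ho] with y hy
      rw [e]
      exact hmax y hy
    have h0 : l = 0 := by simpa using hloc.hasFDerivAt_eq_zero l.hasFDerivAt
    exact hF.2.2 (by rw [hl]; simp [h0])
  have hpos' := sub_pos.2 hpos
  have e : ∀ x, ((l x0 - l o)⁻¹ • l) (x - o) = (l x0 - l o)⁻¹ * (l x - l o) := fun x => by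
    rw [← map_sub l x o]
    rfl
  refine ⟨(l x0 - l o)⁻¹ • l, fun x hx => ?_, fun x hx => ?_⟩
  · rw [e, inv_mul_le_iff₀ hpos', mul_one]
    linarith [hmax x hx]
  · rw [e, inv_mul_eq_one₀ hpos'.ne', hl]
    constructor
    · intro h
      exact ⟨hx, fun y hy => by linarith [hmax y hy]⟩
    · intro h
      linarith [hmax x hx, h.2 x0 hx0P]

/-! ### Recognizing the boundary complex of a simplicial polytope -/

/-- Suppose `q` realizes the vertices of an abstract simplicial complex `K` so that the cones over
the simplices of `K` cover space, and each simplex `s` has a functional `L s` that is at most `1` on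
all vertices, with equality exactly on `s`. Then `K` is the boundary complex of a polytope. -/
structure IsPolytopalRealization {d : ℕ} (K : Set (Finset (Fin d → ℝ))) (V : Finset (Fin d → ℝ))
    (q : (Fin d → ℝ) → (Fin d → ℝ)) (L : Finset (Fin d → ℝ) → StrongDual ℝ (Fin d → ℝ)) :
    Prop where
  nonempty : ∀ s ∈ K, s.Nonempty
  down : ∀ s ∈ K, ∀ t ⊆ s, t.Nonempty → t ∈ K
  subset : ∀ s ∈ K, s ⊆ V
  singleton_mem : ∀ v ∈ V, {v} ∈ K
  le_one : ∀ s ∈ K, ∀ v ∈ V, L s (q v) ≤ 1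
  eq_one : ∀ s ∈ K, ∀ v ∈ V, L s (q v) = 1 ↔ v ∈ s
  cover : ∀ x : Fin d → ℝ, x ≠ 0 → ∃ s ∈ K, ∃ w : (Fin d → ℝ) → ℝ, (∀ v ∈ s, 0 < w v) ∧
    x = ∑ v ∈ s, w v • q v

namespace IsPolytopalRealization

variable {d : ℕ} {K : Set (Finset (Fin d → ℝ))} {V : Finset (Fin d → ℝ)}
  {q : (Fin d → ℝ) → (Fin d → ℝ)} {L : Finset (Fin d → ℝ) → StrongDual ℝ (Fin d → ℝ)}

/-- Covering makes the `q v` positively span space. Applied to `l` and `-l`, this plays the role of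
the origin being interior to the polytope. -/
theorem exists_pos (h : IsPolytopalRealization K V q L) {l : StrongDual ℝ (Fin d → ℝ)}
    (hl : l ≠ 0) : ∃ v ∈ V, 0 < l (q v) := by
  obtain ⟨x, hx⟩ : ∃ x, 0 < l x := by
    by_contra! hc
    refine hl (ContinuousLinearMap.ext fun x => le_antisymm (hc x) ?_)
    simpa using hc (-x)
  obtain ⟨s, hs, w, hw, rfl⟩ := h.cover x (by rintro rfl; simp at hx)
  by_contra! hc
  refine hx.not_ge ?_
  rw [map_sum]
  refine Finset.sum_nonpos fun v hv => ?_
  rw [map_smul, smul_eq_mul]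
  exact mul_nonpos_of_nonneg_of_nonpos (hw v hv).le (hc v (h.subset s hs hv))

theorem injOn (h : IsPolytopalRealization K V q L) : Set.InjOn q V := fun v hv w hw e => by
  have h1 := (h.eq_one {v} (h.singleton_mem v hv) v hv).2 (Finset.mem_singleton_self v)
  rw [e, h.eq_one {v} (h.singleton_mem v hv) w hw, Finset.mem_singleton] at h1
  exact h1.symm

/-- `T = V` gives the faces of the polytope, `T = s` the vertices of a single simplex. -/
theorem maximizers (h : IsPolytopalRealization K V q L) {s : Finset (Fin d → ℝ)} (hs : s ∈ K)
    {T : Set (Fin d → ℝ)} (hT : T ⊆ V) (hsT : (s : Set (Fin d → ℝ)) ⊆ T) :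
    {x ∈ convexHull ℝ (q '' T) | ∀ y ∈ convexHull ℝ (q '' T), L s y ≤ L s x} =
      convexHull ℝ (q '' s) := by
  obtain ⟨v, hv⟩ := h.nonempty s hs
  have h1 := maximizers_convexHull (S := q '' T) (M := 1) (L s : (Fin d → ℝ) →ₗ[ℝ] ℝ)
    (by rintro _ ⟨v, hv, rfl⟩; exact h.le_one s hs v (hT hv))
    ⟨q v, ⟨v, hsT hv, rfl⟩, (h.eq_one s hs v (h.subset s hs hv)).2 hv⟩
  refine h1.trans (congrArg _ ?_)
  ext a
  constructor
  · rintro ⟨⟨v, hv, rfl⟩, e⟩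
    exact ⟨v, (h.eq_one s hs v (hT hv)).1 e, rfl⟩
  · rintro ⟨v, hv, rfl⟩
    exact ⟨⟨v, hsT hv, rfl⟩, (h.eq_one s hs v (h.subset s hs hv)).2 hv⟩

theorem extremePoints_eq (h : IsPolytopalRealization K V q L) {s : Finset (Fin d → ℝ)}
    (hs : s ∈ K) : (convexHull ℝ (q '' s)).extremePoints ℝ = q '' s := by
  refine Set.Subset.antisymm extremePoints_convexHull_subset ?_
  rintro _ ⟨v, hv, rfl⟩
  have h1 := h.maximizers (h.singleton_mem v (h.subset s hs hv)) (T := s) (h.subset s hs)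
    (by simpa using hv)
  have h2 : IsExposed ℝ (convexHull ℝ (q '' s)) {q v} := fun _ => ⟨L {v}, by
    rw [h1]
    simp⟩
  exact isExtreme_singleton.1 h2.isExtreme

theorem isProperFace (h : IsPolytopalRealization K V q L) {s : Finset (Fin d → ℝ)}
    (hs : s ∈ K) : IsProperFace (convexHull ℝ (q '' V)) (convexHull ℝ (q '' s)) := by
  have h1 := h.maximizers hs (T := V) subset_rfl (h.subset s hs)
  refine ⟨(((h.nonempty s hs).to_set).image q).convexHull, fun _ => ⟨L s, h1.symm⟩, fun e => ?_⟩
  have hone : ∀ v ∈ V, L s (q v) = 1 := fun v hv => by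
    have h2 : q v ∈ convexHull ℝ (q '' V) := subset_convexHull ℝ _ ⟨v, hv, rfl⟩
    rw [← e] at h2
    exact convexHull_min (t := {x | L s x = 1})
      (by rintro _ ⟨v, hv, rfl⟩; exact (h.eq_one s hs v (h.subset s hs hv)).2 hv)
      (convex_hyperplane (L s : (Fin d → ℝ) →ₗ[ℝ] ℝ).isLinear 1) h2
  obtain ⟨v0, hv0⟩ := h.nonempty s hs
  have hne : -L s ≠ 0 := fun h0 => by
    have h3 := hone v0 (h.subset s hs hv0)
    rw [neg_eq_zero.1 h0] at h3
    simp at h3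
  obtain ⟨v, hv, hpos⟩ := h.exists_pos hne
  have := hone v hv
  simp only [neg_apply] at hpos
  linarith

/-- Let `S` be the vertices maximizing `l`, with maximum `M > 0`. Their sum lies in the cone of some
`s ∈ K`, with weights `w`. Evaluating `L s` gives `∑ w ≤ |S|`, evaluating `l` gives `|S| M ≤ (∑ w)
M`. Equality throughout forces `S ⊆ s` and `s ⊆ S`. -/
theorem exists_of_isProperFace (h : IsPolytopalRealization K V q L) {G : Set (Fin d → ℝ)}
    (hG : IsProperFace (convexHull ℝ (q '' V)) G) : ∃ s ∈ K, G = convexHull ℝ (q '' s) := by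
  classical
  obtain ⟨l, hl⟩ := hG.2.1 hG.1
  have hl0 : l ≠ 0 := by
    rintro rfl
    exact hG.2.2 (by rw [hl]; simp)
  obtain ⟨v1, hv1, hv1pos⟩ := h.exists_pos hl0
  obtain ⟨v0, hv0, hmax⟩ := Finset.exists_max_image V (fun v => l (q v)) ⟨v1, hv1⟩
  set M := l (q v0) with hM
  have hMpos : 0 < M := hv1pos.trans_le (hmax v1 hv1)
  set S := V.filter fun v => l (q v) = M with hSdef
  have hmemS : ∀ v, v ∈ S ↔ v ∈ V ∧ l (q v) = M := fun v => by simp [hSdef]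
  have hGS : G = convexHull ℝ (q '' S) := by
    rw [hl]
    refine (maximizers_convexHull (S := q '' V) (M := M) (l : (Fin d → ℝ) →ₗ[ℝ] ℝ)
      (by rintro _ ⟨v, hv, rfl⟩; exact hmax v hv) ⟨q v0, ⟨v0, hv0, rfl⟩, rfl⟩).trans
      (congrArg _ ?_)
    ext a
    constructor
    · rintro ⟨⟨v, hv, rfl⟩, e⟩
      exact ⟨v, (hmemS v).2 ⟨hv, e⟩, rfl⟩
    · rintro ⟨v, hv, rfl⟩
      exact ⟨⟨v, ((hmemS v).1 hv).1, rfl⟩, ((hmemS v).1 hv).2⟩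
  have hSne : 0 < (S.card : ℝ) := by
    exact_mod_cast Finset.card_pos.2 ⟨v0, (hmemS v0).2 ⟨hv0, rfl⟩⟩
  have hlx : l (∑ v ∈ S, q v) = S.card * M := by
    rw [map_sum, Finset.sum_congr rfl fun v hv => ((hmemS v).1 hv).2]
    simp
  obtain ⟨s, hs, w, hw, hx⟩ := h.cover (∑ v ∈ S, q v) fun e => by
    rw [e, map_zero] at hlx
    exact (mul_pos hSne hMpos).ne hlx
  have e1 : ∑ v ∈ S, L s (q v) = ∑ v ∈ s, w v := by
    rw [← map_sum, hx, map_sum]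
    refine Finset.sum_congr rfl fun v hv => ?_
    rw [map_smul, (h.eq_one s hs v (h.subset s hs hv)).2 hv, smul_eq_mul, mul_one]
  have e2 : ∑ v ∈ s, w v * l (q v) = S.card * M := by
    rw [← hlx, hx, map_sum]
    simp
  have le1 : ∀ v ∈ S, L s (q v) ≤ 1 := fun v hv => h.le_one s hs v ((hmemS v).1 hv).1
  have le2 : ∀ v ∈ s, w v * l (q v) ≤ w v * M := fun v hv =>
    mul_le_mul_of_nonneg_left (hmax v (h.subset s hs hv)) (hw v hv).le
  have s1 : ∑ v ∈ S, L s (q v) ≤ ∑ v ∈ S, (1 : ℝ) := Finset.sum_le_sum le1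
  have s2 := Finset.sum_le_sum le2
  rw [e2, ← Finset.sum_mul] at s2
  have s3 : (S.card : ℝ) ≤ ∑ v ∈ s, w v := le_of_mul_le_mul_right s2 hMpos
  have s4 : ∑ v ∈ S, (1 : ℝ) = S.card := by simp
  have t1 : ∑ v ∈ S, L s (q v) = ∑ v ∈ S, (1 : ℝ) := by linarith
  have t2 : ∑ v ∈ s, w v * l (q v) = ∑ v ∈ s, w v * M := by
    rw [e2, ← Finset.sum_mul]
    congr 1
    linarith
  refine ⟨s, hs, ?_⟩
  rw [hGS]
  congr 3
  ext v
  constructor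
  · intro hv
    exact (h.eq_one s hs v ((hmemS v).1 hv).1).1
      ((Finset.sum_eq_sum_iff_of_le le1).1 t1 v hv)
  · intro hv
    exact (hmemS v).2 ⟨h.subset s hs hv, mul_left_cancel₀ (hw v hv).ne'
      ((Finset.sum_eq_sum_iff_of_le le2).1 t2 v hv)⟩

/-- In a Radon partition of the vertices of `s`, one part is a face `t`; `L t` is `1` on its hull
and less than `1` on the hull of the other part, so the hulls cannot meet. -/
theorem affineIndependent (h : IsPolytopalRealization K V q L) {s : Finset (Fin d → ℝ)}
    (hs : s ∈ K) : AffineIndependent ℝ (Subtype.val : (q '' s : Set (Fin d → ℝ)) → (Fin d → ℝ)) := by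
  classical
  by_contra hc
  obtain ⟨I, x, hx1, hx2⟩ := Convex.radon_partition hc
  let t := s.filter fun v => q v ∈ Subtype.val '' I
  have ht : t ∈ K := by
    refine h.down s hs t (Finset.filter_subset _ _) ?_
    obtain ⟨a, ha⟩ := convexHull_nonempty_iff.1 ⟨x, hx1⟩
    obtain ⟨⟨_, v, hv, rfl⟩, hb, rfl⟩ := id ha
    exact ⟨v, Finset.mem_filter.2 ⟨hv, ha⟩⟩
  have h1 : L t x = 1 := by
    refine convexHull_min (t := {x | L t x = 1}) ?_
      (convex_hyperplane (L t : (Fin d → ℝ) →ₗ[ℝ] ℝ).isLinear 1) hx1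
    intro a ha
    obtain ⟨⟨_, v, hv, rfl⟩, hb, rfl⟩ := id ha
    exact (h.eq_one t ht v (h.subset s hs hv)).2 (Finset.mem_filter.2 ⟨hv, ha⟩)
  have h2 : L t x < 1 := by
    refine convexHull_min (t := {x | L t x < 1}) ?_
      (convex_halfSpace_lt (L t : (Fin d → ℝ) →ₗ[ℝ] ℝ).isLinear 1) hx2
    intro a ha
    obtain ⟨⟨_, v, hv, rfl⟩, hb, rfl⟩ := id ha
    refine lt_of_le_of_ne (h.le_one t ht v (h.subset s hs hv)) fun e => hb ?_
    obtain ⟨b, hbI, hbe⟩ := (Finset.mem_filter.1 ((h.eq_one t ht v (h.subset s hs hv)).1 e)).2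
    have hbb : b = ⟨q v, v, hv, rfl⟩ := Subtype.ext hbe
    rwa [hbb] at hbI
  exact h2.ne h1

theorem affineSpan_eq_top (h : IsPolytopalRealization K V q L) (hd : 0 < d) :
    affineSpan ℝ (convexHull ℝ (q '' V)) = ⊤ := by
  have hne : (q '' (V : Set (Fin d → ℝ))).Nonempty := by
    have : NeZero d := ⟨hd.ne'⟩
    obtain ⟨s, hs, -⟩ := h.cover 1 one_ne_zero
    obtain ⟨v, hv⟩ := h.nonempty s hs
    exact ⟨q v, v, h.subset s hs hv, rfl⟩
  rw [affineSpan_convexHull, AffineSubspace.affineSpan_eq_top_iff_vectorSpan_eq_top_of_nonempty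
    ℝ _ _ hne]
  by_contra hc
  obtain ⟨f, hf0, hf⟩ := Submodule.exists_le_ker_of_lt_top _ (lt_top_iff_ne_top.2 hc)
  obtain ⟨a, ha⟩ := hne
  have hconst : ∀ v ∈ V, f (q v) = f a := fun v hv => by
    have := hf (vsub_mem_vectorSpan ℝ (Set.mem_image_of_mem q hv) ha)
    simpa [sub_eq_zero] using this
  let l := LinearMap.toContinuousLinearMap f
  have hl : l ≠ 0 := fun e => hf0 (LinearMap.ext fun x => DFunLike.congr_fun e x)
  obtain ⟨v, hv, h1⟩ := h.exists_pos hl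
  obtain ⟨w, hw, h2⟩ := h.exists_pos (neg_ne_zero.2 hl)
  have h1' : 0 < f (q v) := h1
  have h2' : 0 < -f (q w) := h2
  rw [hconst v hv] at h1'
  rw [hconst w hw] at h2'
  linarith

theorem isSimplicialPolytope (h : IsPolytopalRealization K V q L) (hd : 0 < d) :
    IsSimplicialPolytope (convexHull ℝ (q '' V)) := by
  classical
  refine ⟨⟨⟨V.image q, by simp⟩, h.affineSpan_eq_top hd⟩, fun F hF => ?_⟩
  obtain ⟨s, hs, rfl⟩ := h.exists_of_isProperFace hF.1
  rw [h.extremePoints_eq hs]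
  exact h.affineIndependent hs

theorem combinatoriallyEquivalent (h : IsPolytopalRealization K V q L) :
    CombinatoriallyEquivalent K (boundaryComplex (convexHull ℝ (q '' V))) := by
  classical
  refine ⟨q, h.injOn.mono ?_, ?_⟩
  · rintro v ⟨s, hs, hv⟩
    exact h.subset s hs hv
  · ext t
    constructor
    · rintro ⟨s, hs, rfl⟩
      exact ⟨_, h.isProperFace hs, by rw [h.extremePoints_eq hs]; simp⟩
    · rintro ⟨G, hG, e⟩
      obtain ⟨s, hs, rfl⟩ := h.exists_of_isProperFace hG
      rw [h.extremePoints_eq hs] at e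
      exact ⟨s, hs, Finset.coe_injective (by rw [e]; simp)⟩

end IsPolytopalRealization

/-! ### Supporting functionals of the cells of a regular subdivision -/

/-- By Krein–Milman, a non-extreme `v` would lie in the hull of the other points of `s`. -/
theorem AffineIndependent.mem_extremePoints_convexHull {d : ℕ} {s : Finset (Fin d → ℝ)}
    (hs : AffineIndependent ℝ ((↑) : s → (Fin d → ℝ))) {v : Fin d → ℝ} (hv : v ∈ s) :
    v ∈ (convexHull ℝ (s : Set (Fin d → ℝ))).extremePoints ℝ := by
  classical
  by_contra hc
  have hsub : (convexHull ℝ (s : Set (Fin d → ℝ))).extremePoints ℝ ⊆ (s.erase v : Finset _) :=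
    fun x hx => by
      refine Finset.mem_coe.2 (Finset.mem_erase.2 ⟨?_, extremePoints_convexHull_subset hx⟩)
      rintro rfl
      exact hc hx
  have hKM := closure_convexHull_extremePoints
    (s.finite_toSet.isCompact_convexHull ℝ) (convex_convexHull ℝ (s : Set (Fin d → ℝ)))
  have h1 : v ∈ convexHull ℝ ((s.erase v : Finset _) : Set (Fin d → ℝ)) := by
    have h2 : v ∈ closure (convexHull ℝ ((convexHull ℝ (s : Set (Fin d → ℝ))).extremePoints ℝ)) := by
      rw [hKM]
      exact subset_convexHull ℝ _ hv
    exact closure_minimal (convexHull_mono hsub)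
      ((s.erase v).finite_toSet.isCompact_convexHull ℝ).isClosed h2
  have h3 := AffineIndependent.convexHull_inter hs (Finset.erase_subset v s)
    (Finset.singleton_subset_iff.2 hv)
  have h4 : v ∈ convexHull ℝ ((s.erase v : Finset _) : Set (Fin d → ℝ)) ∩
      convexHull ℝ (({v} : Finset (Fin d → ℝ)) : Set (Fin d → ℝ)) := ⟨h1, by simp⟩
  rw [← h3] at h4
  simp at h4

/-- A simplex of a regular subdivision comes with an affine function that lies below the weights
and meets them at the vertices of the simplex, and at no point outside of it. -/
theorem exists_affine_minorant {d : ℕ} {A : Set (Fin d → ℝ)} {ω : (Fin d → ℝ) → ℝ}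
    {s : Finset (Fin d → ℝ)} (hs : AffineIndependent ℝ ((↑) : s → (Fin d → ℝ)))
    (hC : convexHull ℝ (s : Set (Fin d → ℝ)) ∈ regularSubdivision A ω) :
    ∃ (h : StrongDual ℝ (Fin d → ℝ)) (b : ℝ), (∀ v ∈ A, h v + b ≤ ω v) ∧
      (∀ v ∈ A, h v + b = ω v → v ∈ convexHull ℝ (s : Set (Fin d → ℝ))) ∧
      ∀ v ∈ s, v ∈ A ∧ h v + b = ω v := by
  obtain ⟨G, ⟨⟨p, hp⟩, l, hlneg, hG⟩, hsG⟩ := hC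
  have hp' := hp
  rw [hG] at hp'
  obtain ⟨hpL, hmax⟩ := hp'
  set M := l p with hM
  set k := -l (0, 1) with hk
  have hkpos : 0 < k := neg_pos.2 hlneg
  have hl : ∀ v t, l (v, t) = l (v, 0) - t * k := fun v t => by
    have e : ((v, t) : (Fin d → ℝ) × ℝ) = (v, 0) + t • (0, 1) := by simp
    rw [e, map_add, map_smul, smul_eq_mul, hk]
    ring
  -- The hyperplane `l = M` is not vertical, so it is the graph of `v ↦ h v - M / k`, and the gap `ω
  -- v - (h v - M / k)` is `(M - l (v, ω v)) / k`.
  let h : StrongDual ℝ (Fin d → ℝ) := k⁻¹ • l.comp (ContinuousLinearMap.inl ℝ (Fin d → ℝ) ℝ)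
  have hh : ∀ v, h v = k⁻¹ * l (v, 0) := fun v => rfl
  have hle : ∀ a ∈ (fun v => (v, ω v)) '' A, l a ≤ M := fun a ha =>
    hmax a (subset_convexHull ℝ _ ha)
  have hdiff : ∀ v, ω v - (h v + -(k⁻¹ * M)) = k⁻¹ * (M - l (v, ω v)) := fun v => by
    rw [hh, hl v (ω v)]
    field_simp
    ring
  have hiff : ∀ v, h v + -(k⁻¹ * M) = ω v ↔ l (v, ω v) = M := fun v => by
    rw [eq_comm, ← sub_eq_zero, hdiff, mul_eq_zero, or_iff_right (inv_pos.2 hkpos).ne', sub_eq_zero,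
      eq_comm]
  have hsub : convexHull ℝ (s : Set (Fin d → ℝ)) ⊆ convexHull ℝ {v ∈ A | l (v, ω v) = M} := by
    rw [hsG]
    rintro _ ⟨g, hg, rfl⟩
    rw [hG] at hg
    have h1 := mem_convexHull_of_eq_max (l : ((Fin d → ℝ) × ℝ) →ₗ[ℝ] ℝ) hle hg.1
      (le_antisymm (hmax g hg.1) (hg.2 p hpL))
    have h2 : g.1 ∈ LinearMap.fst ℝ (Fin d → ℝ) ℝ '' convexHull ℝ _ := ⟨g, h1, rfl⟩
    rw [LinearMap.image_convexHull] at h2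
    refine convexHull_mono ?_ h2
    rintro _ ⟨_, ⟨⟨v, hv, rfl⟩, e⟩, rfl⟩
    exact ⟨hv, e⟩
  have hsup : {v ∈ A | l (v, ω v) = M} ⊆ convexHull ℝ (s : Set (Fin d → ℝ)) := by
    rintro v ⟨hv, e⟩
    rw [hsG]
    refine ⟨(v, ω v), ?_, rfl⟩
    rw [hG]
    exact ⟨subset_convexHull ℝ _ ⟨v, hv, rfl⟩, fun y hy => by rw [e]; exact hmax y hy⟩
  have heq : convexHull ℝ (s : Set (Fin d → ℝ)) = convexHull ℝ {v ∈ A | l (v, ω v) = M} :=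
    hsub.antisymm (convexHull_min hsup (convex_convexHull ℝ _))
  refine ⟨h, -(k⁻¹ * M), fun v hv => ?_, fun v hv e => hsup ⟨hv, (hiff v).1 e⟩, fun v hv => ?_⟩
  · rw [← sub_nonneg, hdiff]
    exact mul_nonneg (inv_pos.2 hkpos).le (sub_nonneg.2 (hle _ ⟨v, hv, rfl⟩))
  -- Extreme points of the hull of the contact points are contact points, so the vertices of `s` lie
  -- in `A`.
  · have h1 := hs.mem_extremePoints_convexHull hv
    rw [heq] at h1
    have h2 := extremePoints_convexHull_subset h1
    exact ⟨h2.1, (hiff v).2 h2.2⟩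

theorem polytopeBoundary_subset {d : ℕ} (P : Set (Fin d → ℝ)) : polytopeBoundary P ⊆ P := by
  rintro x ⟨F, hF, hx⟩
  exact hF.1.2.1.subset hx

/-- The functionals attached to a simplex of a regular triangulation of the boundary: `l` exposes
the facet containing the simplex, and on this facet `m` is the affine minorant of the weights. -/
theorem exists_facet_and_minorant {d : ℕ} {P : Set (Fin d → ℝ)}
    {Δ : Geometry.SimplicialComplex ℝ (Fin d → ℝ)} {ω : (Fin d → ℝ) → ℝ} {o : Fin d → ℝ}
    (ho : o ∈ interior P) (hΔ : IsBoundaryTriangulation P Δ)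
    (hω : simplices Δ = regularBoundarySubdivision P ω) {s : Finset (Fin d → ℝ)}
    (hs : s ∈ Δ.faces) :
    ∃ l m : StrongDual ℝ (Fin d → ℝ), (∀ v ∈ Δ.vertices, l (v - o) ≤ 1) ∧
      (∀ v ∈ Δ.vertices, l (v - o) = 1 →
        m (v - o) ≤ ω v ∧ (m (v - o) = ω v → v ∈ s)) ∧
      ∀ v ∈ s, l (v - o) = 1 ∧ m (v - o) = ω v := by
  have h1 : convexHull ℝ (s : Set (Fin d → ℝ)) ∈ regularBoundarySubdivision P ω := by
    rw [← hω]
    exact ⟨s, hs, rfl⟩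
  obtain ⟨F, hF, hC⟩ := h1
  obtain ⟨h, b, hle, hin, hon⟩ := exists_affine_minorant (Δ.indep hs) hC
  obtain ⟨l, hl1, hlF⟩ := hF.1.exists_normalized ho
  have hVP : ∀ v ∈ Δ.vertices, v ∈ P := fun v hv => polytopeBoundary_subset P (hΔ.2.1 hv).1
  -- On the hyperplane `l (v - o) = 1` a constant is a multiple of `l`, so the affine minorant
  -- becomes linear in `v - o`.
  have hm : ∀ v, l (v - o) = 1 → (h + (h o + b) • l) (v - o) = h v + b := fun v hv => by
    change h (v - o) + (h o + b) * l (v - o) = _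
    rw [hv, map_sub]
    ring
  refine ⟨l, h + (h o + b) • l, fun v hv => hl1 v (hVP v hv), fun v hv e => ?_, fun v hv => ?_⟩
  · have hvA : v ∈ F ∩ latticePoints d := ⟨(hlF v (hVP v hv)).1 e, (hΔ.2.1 hv).2⟩
    rw [hm v e]
    exact ⟨hle v hvA, fun e' => (Δ.vertex_mem_convexHull_iff hv hs).1 (hin v hvA e')⟩
  · obtain ⟨hvA, e⟩ := hon v hv
    have h1 := (hlF v (hF.1.2.1.subset hvA.1)).2 hvA.1
    exact ⟨h1, by rw [hm v h1, e]⟩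

/-! ### The main theorem -/

/-- A small perturbation of the functionals `l` in the direction `m` is at most `1 + ε ω` on the
vertices, with equality exactly on the given simplex. -/
theorem eventually_perturbation {l m w : ℝ} {p : Prop} (h1 : l ≤ 1)
    (h2 : l = 1 → m ≤ w ∧ (m = w → p)) (h3 : p → l = 1 ∧ m = w) :
    ∀ᶠ ε : ℝ in nhdsWithin 0 (Set.Ioi 0), l + ε * m ≤ 1 + ε * w ∧ (l + ε * m = 1 + ε * w ↔ p) := by
  -- Off the facet, strictness survives small `ε`; on it, the comparison of `m` with `w` decides.
  rcases h1.lt_or_eq with h | h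
  · have hc : Filter.Tendsto (fun ε : ℝ => 1 + ε * w - (l + ε * m)) (nhds 0) (nhds (1 - l)) := by
      have : Continuous fun ε : ℝ => 1 + ε * w - (l + ε * m) := by fun_prop
      simpa using this.tendsto 0
    filter_upwards [(hc.eventually_const_lt (sub_pos.2 h)).filter_mono nhdsWithin_le_nhds] with ε hε
    exact ⟨by linarith, fun e => by linarith, fun hp => absurd (h3 hp).1 h.ne⟩
  · obtain ⟨hle, hp⟩ := h2 h
    filter_upwards [self_mem_nhdsWithin] with ε hε
    have hε : 0 < ε := hε
    refine ⟨?_, fun e => hp ?_, fun hp => ?_⟩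
    · have := mul_le_mul_of_nonneg_left hle hε.le
      linarith
    · exact mul_left_cancel₀ hε.ne' (by linarith)
    · rw [h, (h3 hp).2]

theorem exists_isPolytopalRealization {d : ℕ} {P : Set (Fin d → ℝ)} (hP : IsFullPolytope P)
    {Δ : Geometry.SimplicialComplex ℝ (Fin d → ℝ)} (hΔ : IsRegularBoundaryTriangulation P Δ) :
    ∃ V q L, IsPolytopalRealization Δ.faces V q L := by
  classical
  obtain ⟨hT, ω, hω⟩ := hΔ
  obtain ⟨V0, hV0⟩ := hP.1
  have hconv : Convex ℝ P := hV0 ▸ convex_convexHull ℝ _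
  obtain ⟨o, ho⟩ := hconv.interior_nonempty_iff_affineSpan_eq_top.2 hP.2
  have hVfin : Δ.vertices.Finite :=
    hT.1.preimage (Finset.singleton_injective.injOn)
  set V := hVfin.toFinset with hVdef
  have hV : ∀ v, v ∈ V ↔ v ∈ Δ.vertices := fun v => by simp [hVdef]
  have hsV : ∀ s ∈ Δ.faces, s ⊆ V := fun s hs v hv => (hV v).2 <|
    Δ.down_closed hs (Finset.singleton_subset_iff.2 hv) (Finset.singleton_nonempty v)
  choose! l m hl hlm hs using fun s (hs : s ∈ Δ.faces) =>
    exists_facet_and_minorant ho hT hω hs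
  have hev1 : ∀ᶠ ε : ℝ in nhdsWithin 0 (Set.Ioi 0), ∀ v ∈ V, 0 < 1 + ε * ω v := by
    refine (Filter.eventually_all_finset V).2 fun v _ => Filter.Eventually.filter_mono
      nhdsWithin_le_nhds ?_
    have hc : Filter.Tendsto (fun ε : ℝ => 1 + ε * ω v) (nhds 0) (nhds 1) := by
      have : Continuous fun ε : ℝ => 1 + ε * ω v := by fun_prop
      simpa using this.tendsto 0
    exact hc.eventually_const_lt one_pos
  have hev2 : ∀ᶠ ε : ℝ in nhdsWithin 0 (Set.Ioi 0), ∀ s ∈ Δ.faces, ∀ v ∈ V,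
      l s (v - o) + ε * m s (v - o) ≤ 1 + ε * ω v ∧
        (l s (v - o) + ε * m s (v - o) = 1 + ε * ω v ↔ v ∈ s) :=
    (Filter.eventually_all_finite hT.1).2 fun s hsΔ =>
      (Filter.eventually_all_finset V).2 fun v hv =>
        eventually_perturbation (hl s hsΔ v ((hV v).1 hv)) (hlm s hsΔ v ((hV v).1 hv)) (hs s hsΔ v)
  obtain ⟨ε, hpos, hε⟩ := (hev1.and hev2).exists
  have hL : ∀ s v, (l s + ε • m s) ((1 + ε * ω v)⁻¹ • (v - o)) =
      (1 + ε * ω v)⁻¹ * (l s (v - o) + ε * m s (v - o)) := fun s v => by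
    rw [map_smul]
    rfl
  refine ⟨V, fun v => (1 + ε * ω v)⁻¹ • (v - o), fun s => l s + ε • m s,
    fun s hs => Δ.nonempty_of_mem_faces hs, fun s hs t ht hne => Δ.down_closed hs ht hne, hsV,
    fun v hv => (hV v).1 hv, fun s hs v hv => ?_, fun s hs v hv => ?_, fun x hx => ?_⟩
  · rw [hL, inv_mul_le_iff₀ (hpos v hv), mul_one]
    exact (hε s hs v hv).1
  · rw [hL, inv_mul_eq_one₀ (hpos v hv).ne', eq_comm]
    exact (hε s hs v hv).2
  · obtain ⟨c, hc, hmem⟩ := exists_pos_smul_mem_polytopeBoundary hP ho hx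
    rw [← hT.2.2, Δ.mem_space_iff] at hmem
    obtain ⟨t, ht, hmem⟩ := hmem
    obtain ⟨w, hw0, hw1, hwx⟩ := Finset.mem_convexHull'.1 hmem
    have hsum : ∑ v ∈ t, w v • (v - o) = c • x := by
      simp only [smul_sub, Finset.sum_sub_distrib, hwx, ← Finset.sum_smul, hw1, one_smul]
      abel
    -- `cover` wants strictly positive weights, so vertices with zero barycentric coordinate are
    -- dropped. The factor `c⁻¹` undoes the dilation of `x`, and `1 + ε * ω v` the rescaling in `q
    -- v`.
    refine ⟨t.filter fun v => 0 < w v, Δ.down_closed ht (Finset.filter_subset _ _) ?_,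
      fun v => c⁻¹ * w v * (1 + ε * ω v), fun v hv => ?_, ?_⟩
    · by_contra hne
      rw [Finset.not_nonempty_iff_eq_empty, Finset.filter_eq_empty_iff] at hne
      have := Finset.sum_nonpos fun v hv => not_lt.1 (hne hv)
      linarith
    · obtain ⟨hvt, hwv⟩ := Finset.mem_filter.1 hv
      exact mul_pos (mul_pos (inv_pos.2 hc) hwv) (hpos v (hsV t ht hvt))
    · have h1 : ∀ v ∈ t, (c⁻¹ * w v * (1 + ε * ω v)) • ((1 + ε * ω v)⁻¹ • (v - o)) =
          c⁻¹ • (w v • (v - o)) := fun v hv => by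
        rw [smul_smul, smul_smul, mul_assoc, mul_inv_cancel₀ (hpos v (hsV t ht hv)).ne', mul_one]
      rw [Finset.sum_filter_of_ne, Finset.sum_congr rfl h1, ← Finset.smul_sum, hsum, smul_smul,
        inv_mul_cancel₀ hc.ne', one_smul]
      intro v hv hne
      refine lt_of_le_of_ne (hw0 v hv) fun e => hne ?_
      simp [← e]

theorem not_isProperFace_of_subsingleton {P G : Set (Fin 0 → ℝ)} : ¬ IsProperFace P G := by
  rintro ⟨hne, hexp, hGP⟩
  refine hGP (hexp.subset.antisymm fun x _ => ?_)
  obtain ⟨y, hy⟩ := hne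
  rwa [Subsingleton.elim x y]

theorem mainTheorem10 (d : ℕ) (P : Set (Fin d → ℝ)) (hP : IsLatticePolytope P)
    (Δ : Geometry.SimplicialComplex ℝ (Fin d → ℝ))
    (hΔ : IsRegularBoundaryTriangulation P Δ) :
    ∃ Q : Set (Fin d → ℝ), IsSimplicialPolytope Q ∧
      CombinatoriallyEquivalent Δ.faces (boundaryComplex Q) := by
  have hP' : IsFullPolytope P := ⟨let ⟨V, _, hV⟩ := hP.1; ⟨V, hV⟩, hP.2⟩
  rcases Nat.eq_zero_or_pos d with rfl | hd
  -- For `d = 0` the complex is empty, and the hull of no vertices is not full-dimensional; the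
  -- point `P` itself serves as `Q`.
  · have hfaces : Δ.faces = ∅ := by
      refine Set.eq_empty_of_forall_notMem fun s hs => ?_
      obtain ⟨v, hv⟩ := Δ.nonempty_of_mem_faces hs
      have h1 := Δ.subset_space hs hv
      rw [hΔ.1.2.2] at h1
      obtain ⟨F, hF, -⟩ := h1
      exact not_isProperFace_of_subsingleton hF.1
    have hb : boundaryComplex P = ∅ :=
      Set.eq_empty_of_forall_notMem fun s ⟨G, hG, _⟩ => not_isProperFace_of_subsingleton hG
    refine ⟨P, ⟨hP', fun F hF => absurd hF.1 not_isProperFace_of_subsingleton⟩, id, ?_, ?_⟩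
    · exact Set.injOn_id _
    · rw [hfaces, hb, Set.image_empty]
  · obtain ⟨V, q, L, h⟩ := exists_isPolytopalRealization hP' hΔ
    exact ⟨_, h.isSimplicialPolytope hd, h.combinatoriallyEquivalent⟩
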